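/- For $q>0$, $q\ne 1$, put $[n]_q=\frac{1-q^n}{1-q}$, $[n]_q!=\prod_{j=1}^n[j]_q$, $\binom{n}{k}_q=\frac{[n]_q!}{[k]_q!\,[n-k]_q!}$ and $(a;q)_n=\prod_{j=0}^{n-1}(1-aq^j)$. Let $e_q(t)=\sum_{n\ge0}\frac{t^n}{[n]_q!}$, $E_q(t)=\sum_{n\ge0}q^{n(n-1)/2}\frac{t^n}{[n]_q!}$, and let the Ismail–Mansour $q$-Bernoulli polynomials $B_n(x;q)$ be defined by the (formal) generating function $$\sum_{n\ge0}B_n(x;q)\frac{t^n}{[n]_q!}=\frac{t\,E_q(xt)}{e_q(t/2)E_q(t/2)-1}.$$ An entire function $f$ is said to have $p$-exponential growth of order $k$ (and finite type) if there are real $K>0$ and $\alpha$ with $|f(x)|<K|x|^{\alpha}\exp\left(\frac{k\ln^2|x|}{2\ln^2p}\right)$ for all $x\in\mathbb C\setminus\{0\}$. For $p>1$ put $\delta_k=\frac{(-1;p)_k}{2^k}$ and $T_n(z)=\sum_{k=0}^n\binom{n}{k}_p\delta_k z^{n-k}$; for $h(z)=\sum_n h_nz^n$ put $h(z\dotplus1)=T_p^1h(z)=\sum_n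 h_nT_n(z)$, where this series converges. **Theorem.** Let $p>1$, $q=1/p$, let $c<1$ be real, and let $f(z)=\sum_{n\ge0}a_nz^n$ be an entire function of $p$-exponential growth of order $c\ln p$. Then there is an entire function $g$, given for every $z\in\mathbb C$ by the absolutely convergent series $$g(z)=\sum_{n=0}^\infty\frac{a_n}{[n+1]_q}\,q^{-n(n-1)/2}\,B_{n+1}(z;q),$$ such that for every $z\in\mathbb C$ the series defining $g(z\dotplus1)$ converges absolutely and $$g(z\dotplus1)-g(z)=f(z).$$ -/

import Mathlib

open scoped Nat

noncomputable section

/-- The `q`-number `[n]_q = (1 - q^n) / (1 - q)`, for `q ≠ 1`. -/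
def qNum (q : ℝ) (n : ℕ) : ℝ := (1 - q ^ n) / (1 - q)

/-- The `q`-factorial `[n]_q! = [1]_q [2]_q ⋯ [n]_q`. -/
def qFact (q : ℝ) (n : ℕ) : ℝ := ∏ j ∈ Finset.range n, qNum q (j + 1)

/-- The `q`-binomial coefficient `[n]_q! / ([k]_q! [n-k]_q!)`, for `k ≤ n`. -/
def qBinom (q : ℝ) (n k : ℕ) : ℝ := qFact q n / (qFact q k * qFact q (n - k))

/-- The `q`-shifted factorial `(a; q)_n = ∏_{j < n} (1 - a q^j)`. -/
def qShiftedFact (a q : ℝ) (n : ℕ) : ℝ := ∏ j ∈ Finset.range n, (1 - a * q ^ j)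

/-- The weights `δ_k = (-1; p)_k / 2^k`. -/
def deltaWeight (p : ℝ) (k : ℕ) : ℝ := qShiftedFact (-1) p k / 2 ^ k

/-- `T_n(z) = ∑_{k=0}^n [n choose k]_p z^{n-k} δ_k`, the image of the monomial `z^n` under the
translation operator `T_p^1` with the weights `δ_k`. -/
def translateMonomial (p : ℝ) (n : ℕ) (z : ℂ) : ℂ :=
  ∑ k ∈ Finset.range (n + 1), (qBinom p n k : ℂ) * z ^ (n - k) * (deltaWeight p k : ℂ)

/-- The `n`-th Taylor coefficient of `h` at the origin. -/
def taylorCoeff (h : ℂ → ℂ) (n : ℕ) : ℂ := iteratedDeriv n h 0 / (n ! : ℂ)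

/-- The terms `h_n T_n(z)` of the series that defines `T_p^1 h (z)`, for `h(z) = ∑ h_n z^n`. -/
def translateTerm (p : ℝ) (h : ℂ → ℂ) (z : ℂ) (n : ℕ) : ℂ :=
  taylorCoeff h n * translateMonomial p n z

/-- `T_p^1 h (z) = h(z ∔ 1) = ∑ h_n T_n(z)`; meaningful where the series converges. -/
def qTranslate (p : ℝ) (h : ℂ → ℂ) (z : ℂ) : ℂ := ∑' n, translateTerm p h z n

/-- `f` has `q`-exponential growth of order `k` and a finite type: for some real `K > 0` and `α`,
`|f(x)| < K |x|^α exp(k ln²|x| / (2 ln² q))` for all `x ≠ 0`. -/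
def HasQExpGrowth (q k : ℝ) (f : ℂ → ℂ) : Prop :=
  ∃ K α : ℝ, 0 < K ∧ ∀ x : ℂ, x ≠ 0 →
    ‖f x‖ < K * ‖x‖ ^ α * Real.exp (k * Real.log ‖x‖ ^ 2 / (2 * Real.log q ^ 2))

/-- The series `e_q(t) = ∑ t^n / [n]_q!`. -/
def qExpSmall (q : ℝ) : PowerSeries ℂ := PowerSeries.mk fun n => ((1 / qFact q n : ℝ) : ℂ)

/-- The series `E_q(t) = ∑ q^{n(n-1)/2} t^n / [n]_q!`. -/
def qExpBig (q : ℝ) : PowerSeries ℂ :=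
  PowerSeries.mk fun n => ((q ^ n.choose 2 / qFact q n : ℝ) : ℂ)

/-- The series `e_q(t/2) E_q(t/2)`, with constant term `1`. -/
def qExpHalfProd (q : ℝ) : PowerSeries ℂ :=
  PowerSeries.rescale (1 / 2 : ℂ) (qExpSmall q) * PowerSeries.rescale (1 / 2 : ℂ) (qExpBig q)

/-- The series `(e_q(t/2) E_q(t/2) - 1) / t`. -/
def qBernoulliDenom (q : ℝ) : PowerSeries ℂ :=
  PowerSeries.mk fun n => PowerSeries.coeff (n + 1) (qExpHalfProd q)

/-- The series `t E_q(x t) / (e_q(t/2) E_q(t/2) - 1)` in `t`. -/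
def qBernoulliGen (q : ℝ) (x : ℂ) : PowerSeries ℂ :=
  PowerSeries.rescale x (qExpBig q) * (qBernoulliDenom q)⁻¹

/-- The Ismail–Mansour `q`-Bernoulli polynomials `B_n(x; q)`, given by
`∑ B_n(x; q) t^n / [n]_q! = t E_q(x t) / (e_q(t/2) E_q(t/2) - 1)`. -/
def qBernoulli (q : ℝ) (n : ℕ) (x : ℂ) : ℂ :=
  (qFact q n : ℂ) * PowerSeries.coeff n (qBernoulliGen q x)

/-- The series `qBernoulliGen` is indeed the stated quotient. -/
theorem qBernoulliGen_spec (q : ℝ) (hq : q ≠ 1) (x : ℂ) :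
    qBernoulliGen q x * (qExpHalfProd q - 1) =
      PowerSeries.X * PowerSeries.rescale x (qExpBig q) := by
  have hq' : (1 - q : ℝ) ≠ 0 := sub_ne_zero.mpr (Ne.symm hq)
  have h0 : qFact q 0 = 1 := by simp [qFact]
  have h1 : qFact q 1 = 1 := by simp [qFact, qNum, div_self hq']
  have hc : PowerSeries.coeff 0 (qExpHalfProd q) = 1 := by
    simp [qExpHalfProd, PowerSeries.coeff_mul, qExpSmall, qExpBig, h0,
      PowerSeries.coeff_rescale]
  have hX : qExpHalfProd q - 1 = PowerSeries.X * qBernoulliDenom q := by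
    ext n
    cases n with
    | zero => simp only [map_sub, hc]; simp
    | succ n => simp [PowerSeries.coeff_succ_X_mul, qBernoulliDenom, PowerSeries.coeff_one]
  have hD : PowerSeries.constantCoeff (qBernoulliDenom q) ≠ 0 := by
    rw [← PowerSeries.coeff_zero_eq_constantCoeff_apply]
    simp [qBernoulliDenom, qExpHalfProd, PowerSeries.coeff_mul, qExpSmall, qExpBig, h0, h1,
      PowerSeries.coeff_rescale, Finset.Nat.antidiagonal_succ]
  rw [hX, qBernoulliGen]
  calc _ = PowerSeries.X * PowerSeries.rescale x (qExpBig q) *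
        (qBernoulliDenom q * (qBernoulliDenom q)⁻¹) := by ring
    _ = _ := by rw [PowerSeries.mul_inv_cancel _ hD, mul_one]

end

/-! Write `q = 1/p`, `H = e_q(t/2) E_q(t/2)`, `D = (H - 1)/t` and `w_n = a_n [n]_p!`. In base `p`,
`E_q(zt) = ∑ z^n t^n / [n]_p!`, and `T_n(z) = [n]_p! [t^n] E_q(zt) H` (`translateMonomial_eq`).
Hence `g(z) = ∑ w_n [t^(n+1)] E_q(zt)/D`, and translation only inserts a factor `H`. Since `(H -
1)/D = t`, the difference is `∑ w_n [t^n] E_q(zt) = ∑ a_n z^n`.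

Two estimates justify this: `1/D` has coefficients at most `2^n` (`norm_coeff_inv_le_two_pow`), and
`∑ |w_n| 2^n` converges (`summable_norm_mul_qFact`), because `c < 1` makes `a_n` decay faster than
`p^(-n²/2)`, the inverse of the growth of `[n]_p!`. `hasSum_coeff_mul` then rearranges both double
series. -/

theorem qNum_eq_sum {q : ℝ} (hq : q ≠ 1) (n : ℕ) : qNum q n = ∑ i ∈ Finset.range n, q ^ i := by
  rw [geom_sum_eq hq, qNum, ← neg_div_neg_eq]
  ring

theorem one_le_qNum_succ {q : ℝ} (h0 : 0 ≤ q) (hq : q ≠ 1) (n : ℕ) : 1 ≤ qNum q (n + 1) := by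
  rw [qNum_eq_sum hq, Finset.sum_range_succ']
  have : 0 ≤ ∑ i ∈ Finset.range n, q ^ (i + 1) := Finset.sum_nonneg fun i _ => by positivity
  simp [this]

theorem qFact_succ (q : ℝ) (n : ℕ) : qFact q (n + 1) = qFact q n * qNum q (n + 1) :=
  Finset.prod_range_succ _ _

theorem qFact_zero (q : ℝ) : qFact q 0 = 1 := by simp [qFact]

theorem qFact_pos {q : ℝ} (h0 : 0 ≤ q) (hq : q ≠ 1) (n : ℕ) : 0 < qFact q n :=
  Finset.prod_pos fun j _ => zero_lt_one.trans_le (one_le_qNum_succ h0 hq j)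

theorem natCast_le_qNum {p : ℝ} (hp : 1 < p) (n : ℕ) : (n : ℝ) ≤ qNum p n := by
  rw [qNum_eq_sum hp.ne']
  calc (n : ℝ) = ∑ i ∈ Finset.range n, (1 : ℝ) := by simp
    _ ≤ _ := Finset.sum_le_sum fun i _ => one_le_pow₀ hp.le

theorem factorial_le_qFact {p : ℝ} (hp : 1 < p) (n : ℕ) : (n ! : ℝ) ≤ qFact p n := by
  induction n with
  | zero => simp [qFact_zero]
  | succ n ih =>
    rw [qFact_succ, Nat.factorial_succ, mul_comm, Nat.cast_mul]
    exact mul_le_mul ih (natCast_le_qNum hp _) (by positivity)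
      (qFact_pos (by linarith) hp.ne' n).le

theorem qNum_inv_mul_pow {p : ℝ} (hp : 1 < p) (n : ℕ) :
    qNum p⁻¹ (n + 1) * p ^ n = qNum p (n + 1) := by
  have h0 : p ≠ 0 := by positivity
  have h1 : 1 - p ≠ 0 := by linarith
  have h2 : p - 1 ≠ 0 := by linarith
  unfold qNum
  rw [inv_pow]
  field_simp
  ring

theorem qFact_inv_mul_pow {p : ℝ} (hp : 1 < p) (n : ℕ) :
    qFact p⁻¹ n * p ^ n.choose 2 = qFact p n := by
  induction n with
  | zero => simp [qFact_zero]
  | succ n ih =>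
    rw [qFact_succ, qFact_succ, ← ih, ← qNum_inv_mul_pow hp, Nat.choose_succ_succ' n 1,
      Nat.choose_one_right, pow_add]
    ring

theorem qNum_succ_le {p : ℝ} (hp : 1 < p) (n : ℕ) : qNum p (n + 1) ≤ p ^ n * (p / (p - 1)) := by
  have h1 : 0 < p - 1 := by linarith
  rw [qNum, ← neg_div_neg_eq, neg_sub, neg_sub, ← mul_div_assoc, ← pow_succ]
  gcongr
  linarith

theorem qFact_le {p : ℝ} (hp : 1 < p) (n : ℕ) :
    qFact p n ≤ p ^ n.choose 2 * (p / (p - 1)) ^ n := by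
  have h1 : 0 < p - 1 := by linarith
  induction n with
  | zero => simp [qFact_zero]
  | succ n ih =>
    rw [qFact_succ, Nat.choose_succ_succ' n 1, Nat.choose_one_right]
    calc _ ≤ (p ^ n.choose 2 * (p / (p - 1)) ^ n) * (p ^ n * (p / (p - 1))) :=
          mul_le_mul ih (qNum_succ_le hp n)
            (zero_le_one.trans (one_le_qNum_succ (by linarith) hp.ne' n)) (by positivity)
      _ = _ := by ring

/-! ### Coefficients of `H` and the weights `δ_k`. -/

/-- The coefficients `(-1; q)_n / (2^n [n]_q!)` of `e_q(t/2) E_q(t/2)`. -/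
noncomputable def halfProdCoeff (q : ℝ) (n : ℕ) : ℝ :=
  ∏ j ∈ Finset.range n, (1 + q ^ j) / (2 * qNum q (j + 1))

theorem qNum_add {q : ℝ} (hq : q ≠ 1) (k l : ℕ) : qNum q (k + l) = qNum q k + q ^ k * qNum q l := by
  have : 1 - q ≠ 0 := sub_ne_zero.mpr hq.symm
  unfold qNum
  field_simp
  ring

/-- The recurrence behind the `q`-binomial theorem. -/
theorem sum_antidiagonal_qFact_succ {q : ℝ} (h0 : 0 ≤ q) (hq : q ≠ 1) (n : ℕ) :
    qNum q (n + 1) * ∑ x ∈ Finset.HasAntidiagonal.antidiagonal (n + 1),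
        1 / qFact q x.1 * (q ^ x.2.choose 2 / qFact q x.2) =
      (1 + q ^ n) * ∑ x ∈ Finset.HasAntidiagonal.antidiagonal n,
        1 / qFact q x.1 * (q ^ x.2.choose 2 / qFact q x.2) := by
  have hF : ∀ k, qFact q k ≠ 0 := fun k => (qFact_pos h0 hq k).ne'
  have hN : ∀ k, qNum q (k + 1) ≠ 0 := fun k =>
    (zero_lt_one.trans_le (one_le_qNum_succ h0 hq k)).ne'
  have hz : qNum q 0 = 0 := by simp [qNum]
  -- Split `[k+l] = [k] + q^k [l]`: the first part lowers `[k]!`, the second lowers `[l]!` and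
  -- collects `q^k q^(l-1) = q^n`.
  have split : qNum q (n + 1) * ∑ x ∈ Finset.HasAntidiagonal.antidiagonal (n + 1),
        1 / qFact q x.1 * (q ^ x.2.choose 2 / qFact q x.2) =
      (∑ x ∈ Finset.HasAntidiagonal.antidiagonal (n + 1),
        qNum q x.1 * (1 / qFact q x.1 * (q ^ x.2.choose 2 / qFact q x.2))) +
      ∑ x ∈ Finset.HasAntidiagonal.antidiagonal (n + 1),
        q ^ x.1 * qNum q x.2 * (1 / qFact q x.1 * (q ^ x.2.choose 2 / qFact q x.2)) := by
    rw [Finset.mul_sum, ← Finset.sum_add_distrib]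
    refine Finset.sum_congr rfl fun x hx => ?_
    rw [← Finset.HasAntidiagonal.mem_antidiagonal.mp hx, qNum_add hq]
    ring
  rw [split, Finset.Nat.sum_antidiagonal_succ, Finset.Nat.sum_antidiagonal_succ', hz, add_mul,
    one_mul, zero_mul, zero_add, mul_zero, zero_mul, zero_add, Finset.mul_sum]
  congr 1
  · refine Finset.sum_congr rfl fun x _ => ?_
    have h1 := hF x.1
    have h2 := hF x.2
    have h3 := hN x.1
    simp only [qFact_succ]
    field_simp
  · refine Finset.sum_congr rfl fun x hx => ?_
    have h1 := hF x.1
    have h2 := hF x.2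
    have h3 := hN x.2
    rw [← Finset.HasAntidiagonal.mem_antidiagonal.mp hx]
    simp only [qFact_succ, Nat.choose_succ_succ' _ 1, Nat.choose_one_right, pow_add]
    field_simp

theorem sum_antidiagonal_qFact {q : ℝ} (h0 : 0 ≤ q) (hq : q ≠ 1) (n : ℕ) :
    ∑ x ∈ Finset.HasAntidiagonal.antidiagonal n, 1 / qFact q x.1 * (q ^ x.2.choose 2 / qFact q x.2) =
      2 ^ n * halfProdCoeff q n := by
  induction n with
  | zero => simp [halfProdCoeff, qFact_zero]
  | succ n ih =>
    have h3 : qNum q (n + 1) ≠ 0 := (zero_lt_one.trans_le (one_le_qNum_succ h0 hq n)).ne'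
    apply mul_left_cancel₀ h3
    rw [sum_antidiagonal_qFact_succ h0 hq, ih, halfProdCoeff, halfProdCoeff,
      Finset.prod_range_succ]
    field_simp
    ring

theorem coeff_qExpHalfProd {q : ℝ} (h0 : 0 ≤ q) (hq : q ≠ 1) (n : ℕ) :
    PowerSeries.coeff n (qExpHalfProd q) = (halfProdCoeff q n : ℂ) := by
  have h := congrArg (fun r : ℝ => (1 / 2 : ℂ) ^ n * (r : ℂ)) (sum_antidiagonal_qFact h0 hq n)
  simp only [Complex.ofReal_mul, Complex.ofReal_pow, Complex.ofReal_ofNat] at h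
  rw [← mul_assoc, ← mul_pow, one_div_mul_cancel two_ne_zero, one_pow, one_mul] at h
  rw [← h, qExpHalfProd, PowerSeries.coeff_mul, Complex.ofReal_sum, Finset.mul_sum]
  refine Finset.sum_congr rfl fun x hx => ?_
  rw [← Finset.HasAntidiagonal.mem_antidiagonal.mp hx]
  simp only [PowerSeries.coeff_rescale, qExpSmall, qExpBig, PowerSeries.coeff_mk, pow_add]
  push_cast
  ring

theorem halfProdCoeff_nonneg {q : ℝ} (h0 : 0 ≤ q) (hq : q ≠ 1) (n : ℕ) :
    0 ≤ halfProdCoeff q n :=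
  Finset.prod_nonneg fun j _ => by
    have := one_le_qNum_succ h0 hq j
    positivity

theorem halfProdCoeff_le_one {q : ℝ} (h0 : 0 ≤ q) (hq : q < 1) (n : ℕ) :
    halfProdCoeff q n ≤ 1 := by
  refine Finset.prod_le_one (fun j _ => ?_) fun j _ => ?_ <;>
    have h1 := one_le_qNum_succ h0 hq.ne j
  · positivity
  · rw [div_le_one (by positivity)]
    have := pow_le_one₀ (n := j) h0 hq.le
    linarith

/-- Both `1 + p^j` and `[j+1]_p` are `p^j` times their base `1/p` versions, so the powers cancel. -/
theorem deltaWeight_eq {p : ℝ} (hp : 1 < p) (n : ℕ) :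
    deltaWeight p n = qFact p n * halfProdCoeff p⁻¹ n := by
  rw [deltaWeight, qShiftedFact, qFact, halfProdCoeff, ← Finset.prod_mul_distrib,
    ← Finset.card_range n, ← Finset.prod_const, Finset.card_range, ← Finset.prod_div_distrib]
  refine Finset.prod_congr rfl fun j _ => ?_
  have h0 : 0 < p := by linarith
  have h1 := one_le_qNum_succ (inv_nonneg.2 h0.le) (inv_lt_one_of_one_lt₀ hp).ne j
  rw [← qNum_inv_mul_pow hp, inv_pow]
  generalize qNum p⁻¹ (j + 1) = N at h1 ⊢
  have h2 : N ≠ 0 := by positivity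
  field_simp
  ring

/-! ### The reciprocal of `D`. -/

theorem coeff_qBernoulliDenom {q : ℝ} (h0 : 0 ≤ q) (hq : q ≠ 1) (n : ℕ) :
    PowerSeries.coeff n (qBernoulliDenom q) = (halfProdCoeff q (n + 1) : ℂ) := by
  rw [qBernoulliDenom, PowerSeries.coeff_mk, coeff_qExpHalfProd h0 hq]

/-- The recursion for the reciprocal bounds each coefficient by the sum of the earlier bounds, and
`1 + 2 + ⋯ + 2^n < 2^(n+1)`. -/
theorem norm_coeff_inv_le_two_pow {D : PowerSeries ℂ} (h0 : PowerSeries.constantCoeff D = 1)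
    (hD : ∀ n, ‖PowerSeries.coeff n D‖ ≤ 1) (n : ℕ) :
    ‖PowerSeries.coeff n D⁻¹‖ ≤ 2 ^ n := by
  induction n using Nat.strong_induction_on with
  | _ n ih =>
    have hne : PowerSeries.constantCoeff D ≠ 0 := by simp [h0]
    have h := congrArg (PowerSeries.coeff n) (PowerSeries.mul_inv_cancel D hne)
    cases n with
    | zero => simp [h0]
    | succ n =>
      rw [PowerSeries.coeff_mul, Finset.Nat.sum_antidiagonal_succ, PowerSeries.coeff_one,
        if_neg n.succ_ne_zero, PowerSeries.coeff_zero_eq_constantCoeff_apply, h0, one_mul] at h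
      rw [eq_neg_of_add_eq_zero_left h, norm_neg]
      calc _ ≤ ∑ x ∈ Finset.HasAntidiagonal.antidiagonal n, (2 : ℝ) ^ x.2 := by
            refine (norm_sum_le _ _).trans (Finset.sum_le_sum fun x hx => ?_)
            rw [norm_mul]
            have hx' := Finset.HasAntidiagonal.mem_antidiagonal.mp hx
            exact (mul_le_of_le_one_left (norm_nonneg _) (hD _)).trans (ih _ (by omega))
        _ = ∑ i ∈ Finset.range (n + 1), (2 : ℝ) ^ i := by
            rw [← Finset.Nat.sum_antidiagonal_swap,
              Finset.Nat.sum_antidiagonal_eq_sum_range_succ_mk]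
            rfl
        _ ≤ _ := by
            rw [geom_sum_eq (by norm_num)]
            norm_num

theorem norm_coeff_qBernoulliDenom_inv_le {q : ℝ} (h0 : 0 ≤ q) (hq : q < 1) (n : ℕ) :
    ‖PowerSeries.coeff n (qBernoulliDenom q)⁻¹‖ ≤ 2 ^ n := by
  refine norm_coeff_inv_le_two_pow ?_ (fun n => ?_) n
  · rw [← PowerSeries.coeff_zero_eq_constantCoeff_apply, coeff_qBernoulliDenom h0 hq.ne]
    have : (1 - q) ≠ 0 := by linarith
    simp [halfProdCoeff, qNum, this]
  · rw [coeff_qBernoulliDenom h0 hq.ne, Complex.norm_real, Real.norm_of_nonneg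
      (halfProdCoeff_nonneg h0 hq.ne _)]
    exact halfProdCoeff_le_one h0 hq _

/-! ### Translation as multiplication by `H`, and interchange of sums. -/

theorem coeff_rescale_qExpBig {p : ℝ} (hp : 1 < p) (z : ℂ) (n : ℕ) :
    PowerSeries.coeff n (PowerSeries.rescale z (qExpBig p⁻¹)) = z ^ n / (qFact p n : ℂ) := by
  have h0 : 0 < p := by linarith
  have h1 := (qFact_pos (inv_nonneg.2 h0.le) (inv_lt_one_of_one_lt₀ hp).ne n).ne'
  rw [PowerSeries.coeff_rescale, qExpBig, PowerSeries.coeff_mk, ← qFact_inv_mul_pow hp, inv_pow]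
  push_cast
  simp only [div_eq_mul_inv, mul_inv]
  ring

theorem translateMonomial_eq {p : ℝ} (hp : 1 < p) (n : ℕ) (z : ℂ) :
    translateMonomial p n z = (qFact p n : ℂ) *
      PowerSeries.coeff n (PowerSeries.rescale z (qExpBig p⁻¹) * qExpHalfProd p⁻¹) := by
  have h0 : 0 < p := by linarith
  rw [mul_comm (PowerSeries.rescale _ _), PowerSeries.coeff_mul,
    Finset.Nat.sum_antidiagonal_eq_sum_range_succ_mk, translateMonomial, Finset.mul_sum]
  refine Finset.sum_congr rfl fun k _ => ?_
  have hk : (qFact p k : ℂ) ≠ 0 := Complex.ofReal_ne_zero.2 (qFact_pos h0.le hp.ne' k).ne'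
  rw [coeff_rescale_qExpBig hp,
    coeff_qExpHalfProd (inv_nonneg.2 h0.le) (inv_lt_one_of_one_lt₀ hp).ne, deltaWeight_eq hp,
    qBinom]
  push_cast
  field_simp

theorem norm_coeff_rescale_qExpBig_le {p : ℝ} (hp : 1 < p) (z : ℂ) (n : ℕ) :
    ‖PowerSeries.coeff n (PowerSeries.rescale z (qExpBig p⁻¹))‖ ≤ ‖z‖ ^ n / n ! := by
  rw [coeff_rescale_qExpBig hp, norm_div, norm_pow, Complex.norm_real,
    Real.norm_of_nonneg (qFact_pos (by linarith) hp.ne' n).le]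
  gcongr
  exact factorial_le_qFact hp n

theorem norm_coeff_rescale_qExpBig_mul_le {p : ℝ} (hp : 1 < p) (z : ℂ) (n : ℕ) :
    ‖PowerSeries.coeff n (PowerSeries.rescale z (qExpBig p⁻¹) * qExpHalfProd p⁻¹)‖ ≤
      Real.exp ‖z‖ := by
  have h0 : 0 ≤ p⁻¹ := by positivity
  have h1 : p⁻¹ < 1 := inv_lt_one_of_one_lt₀ hp
  rw [PowerSeries.coeff_mul, Finset.Nat.sum_antidiagonal_eq_sum_range_succ_mk]
  refine (norm_sum_le _ _).trans (le_trans (Finset.sum_le_sum fun k _ => ?_)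
    (Real.sum_le_exp_of_nonneg (norm_nonneg z) (n + 1)))
  rw [norm_mul, coeff_qExpHalfProd h0 h1.ne, Complex.norm_real, Real.norm_of_nonneg
    (halfProdCoeff_nonneg h0 h1.ne _)]
  exact (mul_le_of_le_one_right (norm_nonneg _) (halfProdCoeff_le_one h0 h1 _)).trans
    (norm_coeff_rescale_qExpBig_le hp z k)

/-- Interchange of summation for `∑ w_n [t^{n+1}] (Φ B)`, when `B` has at most geometric growth
and `Φ` has bounded coefficients. -/
theorem hasSum_coeff_mul {w : ℕ → ℂ} (hw : Summable fun n => ‖w n‖ * 2 ^ n) {B : PowerSeries ℂ}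
    (hB : ∀ m, ‖PowerSeries.coeff m B‖ ≤ 2 ^ m) {Φ : PowerSeries ℂ} {M : ℝ}
    (hΦ : ∀ k, ‖PowerSeries.coeff k Φ‖ ≤ M) :
    ∃ S : ℂ, HasSum (fun n => w n * PowerSeries.coeff (n + 1) (Φ * B)) S ∧
      HasSum (fun k => (∑' n, if k ≤ n + 1 then w n * PowerSeries.coeff (n + 1 - k) B else 0) *
        PowerSeries.coeff k Φ) S := by
  set u : ℕ → ℕ → ℂ := fun k n =>
    if k ≤ n + 1 then w n * PowerSeries.coeff (n + 1 - k) B else 0 with hu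
  have hM : 0 ≤ M := (norm_nonneg _).trans (hΦ 0)
  -- The degree drop `n + 1 - k` supplies the factor `2^(-k)` that makes the double series summable
  -- in `k`.
  have hbound : ∀ x : ℕ × ℕ, ‖u x.2 x.1 * PowerSeries.coeff x.2 Φ‖ ≤
      (‖w x.1‖ * 2 ^ x.1) * ((1 / 2 : ℝ) ^ x.2 * (2 * M)) := by
    rintro ⟨n, k⟩
    simp only [hu]
    split_ifs with h
    · rw [norm_mul, norm_mul]
      have h2 : (2 : ℝ) ^ (n + 1 - k) = 2 ^ n * 2 * (1 / 2) ^ k := by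
        rw [← pow_succ, pow_sub₀ _ two_ne_zero h, one_div, inv_pow]
      calc _ ≤ ‖w n‖ * 2 ^ (n + 1 - k) * M := by
            gcongr
            · exact hB _
            · exact hΦ _
        _ = _ := by rw [h2]; ring
    · rw [zero_mul, norm_zero]
      positivity
  have hsum : Summable fun x : ℕ × ℕ => u x.2 x.1 * PowerSeries.coeff x.2 Φ := by
    refine Summable.of_norm_bounded (Summable.mul_of_nonneg hw
      (summable_geometric_two.mul_right (2 * M)) (fun n => ?_) fun k => ?_) hbound <;>
    · simp only [Pi.zero_apply]
      positivity
  obtain ⟨S, hS⟩ := hsum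
  refine ⟨S, hS.prod_fiberwise fun n => ?_, ?_⟩
  · have : w n * PowerSeries.coeff (n + 1) (Φ * B) =
        ∑ k ∈ Finset.range (n + 2), u k n * PowerSeries.coeff k Φ := by
      rw [PowerSeries.coeff_mul, Finset.Nat.sum_antidiagonal_eq_sum_range_succ_mk, Finset.mul_sum]
      refine Finset.sum_congr rfl fun k hk => ?_
      rw [hu]
      simp only
      rw [if_pos (by have := Finset.mem_range.mp hk; omega)]
      ring
    rw [this]
    refine hasSum_sum_of_ne_finset_zero fun k hk => ?_
    rw [hu]
    simp only
    rw [if_neg (by rw [Finset.mem_range] at hk; omega), zero_mul]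
  · have hS' : HasSum (fun x : ℕ × ℕ => u x.1 x.2 * PowerSeries.coeff x.1 Φ) S :=
      (Equiv.prodComm ℕ ℕ).hasSum_iff.mpr hS
    have hu' : ∀ k, Summable (u k) := fun k => by
      refine Summable.of_norm_bounded (hw.mul_right 2) fun n => ?_
      simp only [hu]
      split_ifs with h
      · rw [norm_mul]
        calc _ ≤ ‖w n‖ * 2 ^ (n + 1) := by
              gcongr
              exact (hB _).trans (pow_le_pow_right₀ one_le_two (Nat.sub_le _ _))
          _ = _ := by ring
      · rw [norm_zero]
        positivity
    have hu'' : ∀ k, HasSum (fun n => u k n * PowerSeries.coeff k Φ)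
        ((∑' n, u k n) * PowerSeries.coeff k Φ) := fun k => (hu' k).hasSum.mul_right _
    exact hS'.prod_fiberwise hu''

/-! ### Entire series and growth estimates. -/

theorem hasFPowerSeriesOnBall_of_hasSum {f : ℂ → ℂ} {a : ℕ → ℂ}
    (h : ∀ z : ℂ, HasSum (fun n => a n * z ^ n) (f z)) :
    HasFPowerSeriesOnBall f (FormalMultilinearSeries.ofScalars ℂ a) 0 ⊤ := by
  refine ⟨?_, ENNReal.coe_lt_top, fun {y} _ => ?_⟩
  · refine (ENNReal.eq_top_of_forall_nnreal_le fun r => ?_).ge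
    refine FormalMultilinearSeries.le_radius_of_tendsto _ (l := 0) ?_
    have := (h (r : ℂ)).summable.tendsto_atTop_zero.norm
    simpa [FormalMultilinearSeries.ofScalars_norm] using this
  · simpa [FormalMultilinearSeries.ofScalars_apply_eq, mul_comm] using h y

theorem taylorCoeff_eq_of_hasSum {f : ℂ → ℂ} {a : ℕ → ℂ}
    (h : ∀ z : ℂ, HasSum (fun n => a n * z ^ n) (f z)) (n : ℕ) : taylorCoeff f n = a n := by
  have h1 := (hasFPowerSeriesOnBall_of_hasSum h).hasFPowerSeriesAt
  have h2 := h1.eq_formalMultilinearSeries h1.analyticAt.hasFPowerSeriesAt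
  have h3 := congrArg (fun P => FormalMultilinearSeries.coeff P n) h2
  simp only [FormalMultilinearSeries.coeff_ofScalars] at h3
  rw [h3, taylorCoeff, div_eq_inv_mul]

theorem differentiable_of_hasSum {f : ℂ → ℂ} {a : ℕ → ℂ}
    (h : ∀ z : ℂ, HasSum (fun n => a n * z ^ n) (f z)) : Differentiable ℂ f := fun z =>
  ((hasFPowerSeriesOnBall_of_hasSum h).analyticAt_of_mem (by simp)).differentiableAt

theorem summable_exp_linear_sub_sq (β : ℝ) {ε : ℝ} (hε : 0 < ε) :
    Summable fun n : ℕ => Real.exp (β * n - ε * n ^ 2) := by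
  refine Summable.of_norm_bounded_eventually_nat (g := fun n : ℕ => Real.exp (n * (-1 : ℝ)))
    (Real.summable_exp_nat_mul_iff.2 (by norm_num)) ?_
  filter_upwards [Filter.eventually_ge_atTop ⌈(β + 1) / ε⌉₊] with n hn
  rw [Real.norm_of_nonneg (Real.exp_pos _).le, Real.exp_le_exp]
  have h1 : (β + 1) / ε ≤ n := (Nat.le_ceil _).trans (by exact_mod_cast hn)
  rw [div_le_iff₀ hε] at h1
  nlinarith [mul_nonneg (Nat.cast_nonneg (α := ℝ) n) (sub_nonneg.2 h1)]

/-- Cauchy's estimates on the circle of radius `p ^ (s n)`. -/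
theorem norm_taylorCoeff_le {p s K α : ℝ} (hp : 1 < p) (hs : 0 < s) {f : ℂ → ℂ}
    (hf : Differentiable ℂ f)
    (hK : ∀ x : ℂ, x ≠ 0 → ‖f x‖ ≤
      K * ‖x‖ ^ α * Real.exp (s⁻¹ * Real.log p * Real.log ‖x‖ ^ 2 / (2 * Real.log p ^ 2))) (n : ℕ) :
    ‖taylorCoeff f n‖ ≤ K * Real.exp (Real.log p * (α * s * n - s / 2 * n ^ 2)) := by
  have hl : 0 < Real.log p := Real.log_pos hp
  -- With `x = log_p r`, the exponent `x²/(2s) - n x` is least at `x = s n`; the factor `r^α` adds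
  -- only a linear term.
  set r : ℝ := Real.exp (Real.log p * (s * n)) with hr
  have hr0 : 0 < r := Real.exp_pos _
  have hC : ∀ x ∈ Metric.sphere (0 : ℂ) r, ‖f x‖ ≤
      K * r ^ α * Real.exp (s⁻¹ * Real.log p * Real.log r ^ 2 / (2 * Real.log p ^ 2)) := by
    intro x hx
    rw [mem_sphere_zero_iff_norm] at hx
    have := hK x (norm_pos_iff.1 (hx ▸ hr0))
    rwa [hx] at this
  have h := Complex.norm_iteratedDeriv_le_of_forall_mem_sphere_norm_le n hr0 hf.diffContOnCl hC
  have hn : (0 : ℝ) < n ! := by positivity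
  rw [taylorCoeff, norm_div, Complex.norm_natCast, div_le_iff₀ hn]
  refine h.trans (le_of_eq ?_)
  have e1 : r ^ α = Real.exp (Real.log p * (s * n) * α) := (Real.exp_mul _ _).symm
  have e2 : r ^ n = Real.exp (n * (Real.log p * (s * n))) := (Real.exp_nat_mul _ _).symm
  have e3 : Real.log r = Real.log p * (s * n) := Real.log_exp _
  have e4 : Real.log p * (α * s * n - s / 2 * n ^ 2) = Real.log p * (s * n) * α +
      s⁻¹ * Real.log p * (Real.log p * (s * n)) ^ 2 / (2 * Real.log p ^ 2) -
      n * (Real.log p * (s * n)) := by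
    field_simp
    ring
  rw [e1, e2, e3, e4, Real.exp_sub, Real.exp_add]
  ring

theorem summable_norm_mul_qFact {p : ℝ} (hp : 1 < p) {c : ℝ} (hc : c < 1) {f : ℂ → ℂ}
    (hf : Differentiable ℂ f) (hgrowth : HasQExpGrowth p (c * Real.log p) f) :
    Summable fun n => ‖taylorCoeff f n * (qFact p n : ℂ)‖ * 2 ^ n := by
  obtain ⟨K, α, hK, h⟩ := hgrowth
  have hl : 0 < Real.log p := Real.log_pos hp
  have hp0 : 0 < p := by linarith
  have hp1 : 0 < p - 1 := by linarith
  -- Raising `c` to `d` in `(0, 1)` covers `c ≤ 0`; `s = 1/d > 1` leaves the quadratic decay `(s -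
  -- 1)/2`.
  obtain ⟨d, hd, hd1⟩ := exists_between (max_lt hc one_pos)
  obtain ⟨hcd, hd0⟩ := max_lt_iff.1 hd
  set s := d⁻¹ with hs
  have hs1 : 1 < s := (one_lt_inv₀ hd0).2 hd1
  have hcoef := norm_taylorCoeff_le (K := K) (α := α) hp (inv_pos.2 hd0) hf (fun x hx =>
    (h x hx).le.trans (by rw [inv_inv]; gcongr))
  set D := 2 * (p / (p - 1)) with hD
  have hD0 : 0 < D := by positivity
  refine Summable.of_nonneg_of_le (fun n => by positivity) (fun n => ?_)
    ((summable_exp_linear_sub_sq (Real.log p * (α * s) - Real.log p / 2 + Real.log D)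
      (ε := Real.log p * (s - 1) / 2) (by have := sub_pos.2 hs1; positivity)).mul_left K)
  have e1 : p ^ n.choose 2 = Real.exp (Real.log p * ((n : ℝ) * (n - 1) / 2)) := by
    rw [← Nat.cast_choose_two ℝ n, mul_comm, Real.exp_nat_mul, Real.exp_log hp0]
  have e2 : D ^ n = Real.exp (n * Real.log D) := by rw [Real.exp_nat_mul, Real.exp_log hD0]
  rw [norm_mul, Complex.norm_real, Real.norm_of_nonneg (qFact_pos hp0.le hp.ne' n).le]
  calc _ ≤ (K * Real.exp (Real.log p * (α * s * n - s / 2 * n ^ 2))) *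
          (p ^ n.choose 2 * (p / (p - 1)) ^ n) * 2 ^ n := by
        gcongr
        · exact (qFact_pos hp0.le hp.ne' n).le
        · exact hcoef n
        · exact qFact_le hp n
    _ = K * (Real.exp (Real.log p * (α * s * n - s / 2 * n ^ 2)) * (p ^ n.choose 2 * D ^ n)) := by
        rw [hD, mul_pow]; ring
    _ = _ := by
        rw [e1, e2, ← Real.exp_add, ← Real.exp_add]
        congr 2
        ring

theorem mainTheorem7 (p : ℝ) (hp : 1 < p) (c : ℝ) (hc : c < 1)
    (f : ℂ → ℂ) (hf : Differentiable ℂ f)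
    (a : ℕ → ℂ) (ha : ∀ z : ℂ, HasSum (fun n => a n * z ^ n) (f z))
    (hgrowth : HasQExpGrowth p (c * Real.log p) f) :
    ∃ g : ℂ → ℂ, Differentiable ℂ g ∧
      (∀ z : ℂ, HasSum
        (fun n => a n / (qNum p⁻¹ (n + 1) : ℂ) * (((p⁻¹ ^ n.choose 2)⁻¹ : ℝ) : ℂ) *
          qBernoulli p⁻¹ (n + 1) z) (g z)) ∧
      (∀ z : ℂ, Summable (translateTerm p g z)) ∧
      ∀ z : ℂ, qTranslate p g z - g z = f z := by
  have hp0 : 0 < p := by linarith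
  have hq0 : 0 ≤ p⁻¹ := by positivity
  have hq1 : p⁻¹ < 1 := inv_lt_one_of_one_lt₀ hp
  have hF : ∀ n, (qFact p n : ℂ) ≠ 0 := fun n =>
    Complex.ofReal_ne_zero.2 (qFact_pos hp0.le hp.ne' n).ne'
  have hw : Summable fun n => ‖a n * (qFact p n : ℂ)‖ * 2 ^ n := by
    simpa only [taylorCoeff_eq_of_hasSum ha] using summable_norm_mul_qFact hp hc hf hgrowth
  have hB := norm_coeff_qBernoulliDenom_inv_le hq0 hq1
  have hterm : ∀ z n, a n / (qNum p⁻¹ (n + 1) : ℂ) * (((p⁻¹ ^ n.choose 2)⁻¹ : ℝ) : ℂ) *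
      qBernoulli p⁻¹ (n + 1) z =
      a n * (qFact p n : ℂ) * PowerSeries.coeff (n + 1) (qBernoulliGen p⁻¹ z) := by
    intro z n
    have h1 : (qNum p⁻¹ (n + 1) : ℂ) ≠ 0 := Complex.ofReal_ne_zero.2
      (zero_lt_one.trans_le (one_le_qNum_succ hq0 hq1.ne n)).ne'
    rw [qBernoulli, qFact_succ, ← qFact_inv_mul_pow hp, inv_pow, inv_inv]
    push_cast
    generalize (qNum p⁻¹ (n + 1) : ℂ) = N at h1 ⊢
    rw [div_mul_eq_mul_div, div_mul_eq_mul_div, div_eq_iff h1]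
    ring
  have hg := fun z : ℂ => hasSum_coeff_mul hw hB (Φ := PowerSeries.rescale z (qExpBig p⁻¹))
    (M := Real.exp ‖z‖) fun k => (norm_coeff_rescale_qExpBig_le hp z k).trans
      (Real.pow_div_factorial_le_exp _ (norm_nonneg z) k)
  have hT := fun z : ℂ => hasSum_coeff_mul hw hB (norm_coeff_rescale_qExpBig_mul_le hp z)
  -- `γ` does not depend on `z` or on the factor `H`, so it gives both the Taylor coefficients `γ_k
  -- / [k]_p!` of `g` and the terms of its translate.
  set γ : ℕ → ℂ := fun k => ∑' n, if k ≤ n + 1 then a n * (qFact p n : ℂ) *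
    PowerSeries.coeff (n + 1 - k) (qBernoulliDenom p⁻¹)⁻¹ else 0
  choose g hg1 hg2 using hg
  choose G hG1 hG2 using hT
  have hpow : ∀ z, HasSum (fun k => γ k / (qFact p k : ℂ) * z ^ k) (g z) := fun z => by
    have h := hg2 z
    simp only [coeff_rescale_qExpBig hp, mul_div_assoc'] at h
    simp only [div_mul_eq_mul_div]
    exact h
  have htr : ∀ z, HasSum (translateTerm p g z) (G z) := fun z => by
    have : translateTerm p g z = fun k => γ k * PowerSeries.coeff k
        (PowerSeries.rescale z (qExpBig p⁻¹) * qExpHalfProd p⁻¹) := by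
      funext k
      rw [translateTerm, taylorCoeff_eq_of_hasSum hpow, translateMonomial_eq hp, ← mul_assoc,
        div_mul_cancel₀ _ (hF k)]
    rw [this]
    exact hG2 z
  refine ⟨g, differentiable_of_hasSum hpow, fun z => ?_, fun z => (htr z).summable, fun z => ?_⟩
  · simp only [hterm]
    exact hg1 z
  · rw [qTranslate, (htr z).tsum_eq]
    have hsub := (hG1 z).sub (hg1 z)
    have hcoeff : ∀ n, PowerSeries.coeff (n + 1) (PowerSeries.rescale z (qExpBig p⁻¹) *
          qExpHalfProd p⁻¹ * (qBernoulliDenom p⁻¹)⁻¹) - PowerSeries.coeff (n + 1)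
          (PowerSeries.rescale z (qExpBig p⁻¹) * (qBernoulliDenom p⁻¹)⁻¹) =
        z ^ n / (qFact p n : ℂ) := fun n => by
      have h := congrArg (PowerSeries.coeff (n + 1)) (qBernoulliGen_spec p⁻¹ hq1.ne z)
      rwa [PowerSeries.coeff_succ_X_mul, coeff_rescale_qExpBig hp, mul_sub_one, map_sub,
        qBernoulliGen, mul_right_comm] at h
    have hterms : ∀ n, a n * (qFact p n : ℂ) * (z ^ n / (qFact p n : ℂ)) = a n * z ^ n :=
      fun n => by rw [mul_assoc, mul_div_cancel₀ _ (hF n)]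
    simp only [← mul_sub, hcoeff, hterms] at hsub
    exact hsub.unique (ha z)
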